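/- **Setting.** Let $p,n\ge 1$ and let $\mathcal S$ be either $\mathcal M^p=\{\Theta\in\mathbb R^{p\times p}:\Theta \text{ symmetric positive definite},\ \Theta_{ij}\le 0\ \forall i\ne j\}$ or $\mathcal M_D^p=\{\Theta\in\mathcal M^p:\Theta\mathbf 1\ge \mathbf 0\}$. Let $x^{(1)},\dots,x^{(n)}$ be i.i.d. $\mathcal N(0,\Sigma^\star)$ with $\Sigma^\star$ positive definite and $\Theta^\star=(\Sigma^\star)^{-1}\in\mathcal S$, and let $\widehat\Sigma=\frac1n\sum_{t=1}^n x^{(t)}(x^{(t)})^\top$. Put $S^\star=\{(i,j):i\neq j,\ \Theta^\star_{ij}\ne0\}$, $I_p=\{(i,i):1\le i\le p\}$, $c_0=12\,\lambda_{\max}(\Theta^\star)^2$, $c_1=(80\max_i\Sigma^\star_{ii})^2$ and $\rho=(2+\sqrt2)/4$. For a matrix $A$ and a set $T$ of positions, $\|A_T\|$ is the Euclidean norm of the vector of the entries of $A$ indexed by $T$. **Multi-stage estimates.** Given $\lambda\ge 0$ and a function $p_\lambda:[0,\infty)\to[0,\infty)$, let $\widehat\Theta^{(0)}$ be any matrix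 with zero off-diagonal entries, and for $k\ge1$ let $\widehat\Theta^{(k)}$ be a minimizer over $\Theta\in\mathcal S$ of $$-\log\det\Theta+\operatorname{tr}(\Theta\widehat\Sigma)+\sum_{i\ne j}\lambda^{(k)}_{ij}|\Theta_{ij}|,$$ where $\lambda^{(1)}_{ij}=\lambda$ and $\lambda^{(k)}_{ij}=p_\lambda(|\widehat\Theta^{(k-1)}_{ij}|)$ for $k\ge2$ (whenever these minimizers exist). **Theorem.** Let $\tau>2$, let $\lambda=\sqrt{c_1\tau\log p/n}$, let $s$ be a natural number, and assume: 1. $p_\lambda$ is nonincreasing, $p_\lambda(0)=\lambda$, and there is $\gamma>0$ with $p_\lambda(x)=0$ for all $x\ge\gamma\lambda$; moreover $p_\lambda(c_0\lambda)\ge\frac{\sqrt2}{2}\lambda$; 2. $\Theta^\star$ has at most $s$ nonzero entries (diagonal entries included), $|\Theta^\star_{ij}|\ge(c_0+\gamma)\lambda$ for all $(i,j)\in S^\star$, and $0<\delta\le\lambda_{\min}(\Theta^\star)\le\lambda_{\max}(\Theta^\star)\le1/\delta$ for some $\delta$; 3. $n\ge 8c_0c_1\tau s\log p$. Then, with probability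 at least $1-4/p^{\tau-2}$, simultaneously for all $k\ge0$ and all multi-stage estimates, $$\|\widehat\Theta^{(k)}-\Theta^\star\|_F\le 4c_0\,\big\|(\Sigma^\star-\widehat\Sigma)_{S^\star\cup I_p}\big\|+\rho^k\,\|\widehat\Theta^{(0)}-\Theta^\star\|_F .$$ -/

import Mathlib

open MeasureTheory ProbabilityTheory

noncomputable section

namespace MTP2

/-- The set `𝓜^p` of symmetric positive definite M-matrices: positive definite matrices
whose off-diagonal entries are nonpositive (over `ℝ`, `PosDef` includes symmetry). -/
def MMatrices (p : ℕ) : Set (Matrix (Fin p) (Fin p) ℝ) :=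
  {Θ | Θ.PosDef ∧ ∀ i j, i ≠ j → Θ i j ≤ 0}

/-- The set `𝓜_D^p` of diagonally dominant M-matrices: M-matrices with `Θ 1 ≥ 0`. -/
def DDMMatrices (p : ℕ) : Set (Matrix (Fin p) (Fin p) ℝ) :=
  {Θ | Θ ∈ MMatrices p ∧ ∀ i, 0 ≤ ∑ j, Θ i j}

/-- Largest eigenvalue of a symmetric matrix. -/
def lamMax {p : ℕ} (A : Matrix (Fin p) (Fin p) ℝ) : ℝ := sSup (spectrum ℝ A)

/-- Smallest eigenvalue of a symmetric matrix. -/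
def lamMin {p : ℕ} (A : Matrix (Fin p) (Fin p) ℝ) : ℝ := sInf (spectrum ℝ A)

/-- The Frobenius norm. -/
def frobNorm {p : ℕ} (A : Matrix (Fin p) (Fin p) ℝ) : ℝ :=
  letI := Matrix.frobeniusNormedAddCommGroup (m := Fin p) (n := Fin p) (α := ℝ)
  ‖A‖

theorem frobNorm_eq_sqrt {p : ℕ} (A : Matrix (Fin p) (Fin p) ℝ) :
    frobNorm A = Real.sqrt (∑ i, ∑ j, A i j ^ 2) := by
  unfold frobNorm
  rw [Matrix.frobenius_norm_def, Real.sqrt_eq_rpow]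
  simp

/-- The Euclidean norm `‖A_T‖` of the vector of the entries of `A` indexed by `T`. -/
def entryNorm {p : ℕ} (A : Matrix (Fin p) (Fin p) ℝ) (T : Finset (Fin p × Fin p)) : ℝ :=
  Real.sqrt (∑ e ∈ T, A e.1 e.2 ^ 2)

/-- The off-diagonal support of a matrix. -/
def offDiagSupport {p : ℕ} (Θ : Matrix (Fin p) (Fin p) ℝ) : Finset (Fin p × Fin p) :=
  Finset.univ.filter fun e => Θ e.1 e.2 ≠ 0 ∧ e.1 ≠ e.2

/-- The set `I_p` of diagonal positions. -/
def diagPositions (p : ℕ) : Finset (Fin p × Fin p) :=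
  Finset.univ.filter fun e => e.1 = e.2

/-- The sample covariance matrix `(1/n) ∑ x⁽ᵗ⁾ x⁽ᵗ⁾ᵀ` of `n` (zero-mean) observations. -/
def sampleCov {p n : ℕ} (x : Fin n → EuclideanSpace ℝ (Fin p)) : Matrix (Fin p) (Fin p) ℝ :=
  Matrix.of fun i j => (1 / (n : ℝ)) * ∑ t, x t i * x t j

/-- The weighted `ℓ₁`-penalized Gaussian negative log-likelihood
`-log det Θ + tr (Θ Σ̂) + ∑_{i ≠ j} Λᵢⱼ |Θᵢⱼ|`. -/
def objective {p : ℕ} (Shat Λ Θ : Matrix (Fin p) (Fin p) ℝ) : ℝ :=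
  -Real.log Θ.det + (Θ * Shat).trace
    + ∑ i, ∑ j, if i ≠ j then Λ i j * |Θ i j| else 0

/-- The weights of stage `k + 1`: all equal to `lam` in the first stage, and `w |Θ⁽ᵏ⁾ᵢⱼ|`
in the later ones, where `w` is the weight-updating function. -/
def stageWeights {p : ℕ} (w : ℝ → ℝ) (lam : ℝ) (Θ : ℕ → Matrix (Fin p) (Fin p) ℝ) :
    ℕ → Matrix (Fin p) (Fin p) ℝ
  | 0 => Matrix.of fun _ _ => lam
  | k + 1 => Matrix.of fun i j => w |Θ (k + 1) i j|

/-- `Θ 1, …, Θ K` are the estimates of the first `K` stages of the adaptive method over the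
feasible set `S`: each is a minimizer over `S` of the objective of its stage. `Θ 0` is an initial
matrix with vanishing off-diagonal entries. -/
structure IsMultiStage {p : ℕ} (S : Set (Matrix (Fin p) (Fin p) ℝ))
    (Shat : Matrix (Fin p) (Fin p) ℝ) (w : ℝ → ℝ) (lam : ℝ) (K : ℕ)
    (Θ : ℕ → Matrix (Fin p) (Fin p) ℝ) : Prop where
  init : ∀ i j, i ≠ j → Θ 0 i j = 0
  mem : ∀ k < K, Θ (k + 1) ∈ S
  isMin : ∀ k < K, IsMinOn (objective Shat (stageWeights w lam Θ k)) S (Θ (k + 1))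

/-- Conditions on the weight-updating function `w : ℝ₊ → ℝ₊` with regularization parameter
`lam`; the values of `w` at negative numbers are irrelevant. -/
structure WeightCond (w : ℝ → ℝ) (lam γ c₀ : ℝ) : Prop where
  nonneg : ∀ x, 0 ≤ x → 0 ≤ w x
  anti : AntitoneOn w (Set.Ici 0)
  at_zero : w 0 = lam
  gamma_pos : 0 < γ
  vanish : ∀ x, γ * lam ≤ x → w x = 0
  lower : Real.sqrt 2 / 2 * lam ≤ w (c₀ * lam)

/-- Conditions on the true precision matrix: at most `s` nonzero entries (diagonal included),
minimal signal strength off the diagonal, and eigenvalues in `[δ, 1/δ]` for some `δ > 0`. -/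
structure PrecisionCond {p : ℕ} (Θ : Matrix (Fin p) (Fin p) ℝ) (s : ℕ) (lam γ c₀ : ℝ) :
    Prop where
  sparse : (Finset.univ.filter fun e : Fin p × Fin p => Θ e.1 e.2 ≠ 0).card ≤ s
  signal : ∀ e ∈ offDiagSupport Θ, (c₀ + γ) * lam ≤ |Θ e.1 e.2|
  eigen : ∃ δ : ℝ, 0 < δ ∧ δ ≤ lamMin Θ ∧ lamMin Θ ≤ lamMax Θ ∧ lamMax Θ ≤ 1 / δ

end MTP2

end

/-!
The argument separates a deterministic recursion from one concentration event.

Let `B` be the estimate of a stage, `D = B - Th` and `L = lamMax Th`. On M-matrices the penalty is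
linear, and the feasible set is convex. Comparing `B` with the points of the segment from `B` to
`Th`, and using that `log det` is concave, gives (`basic_inequality`)
`‖D‖² / (L (L + ‖D‖)) ≤ ∑ Dᵢⱼ (Sig - Shat + N)ᵢⱼ`, where `N` carries the off-diagonal weights.
The left side comes from `tr (A⁻¹ D C⁻¹ D) ≥ ‖D‖² / (lamMax A * lamMax C)`; no a priori
localization of `B` is needed, since `‖D‖ / (L + ‖D‖)` is increasing in `‖D‖`.

On the right side (`entry_bound`), suppose that all entries of `Sig - Shat` are at most
`√2 / 2 * lam`. Off the support of `Th` the entries of `D` are nonpositive, so they only matter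
where the weight is below the noise, that is, where the previous estimate exceeds `c₀ * lam`; on
the support the weight only matters where the previous estimate is below `γ * lam`, hence at
distance at least `c₀ * lam` from the entry of `Th`. In both cases the weight or noise is at most
`lam`, while the previous error is at least `c₀ * lam` in that position. So the right side is at
most `(ε + ‖previous error‖ / c₀) * ‖D‖`, with `ε` the norm of the noise on the support and the
diagonal. The sample size makes `L * lam * √s` small, which forces `‖D‖ ≤ L` at every stage, and
the recursion contracts (`multiStage_error_le`).

The event that all entries of `Sig - Shat` are below `√2 / 2 * lam` has the required probability
(`exists_event_abs_sampleCov_sub_lt`): by polarization each entry is a difference of empirical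
second moments of Gaussian samples, whose tails follow from the Chernoff bound and the moment
generating function of a Gaussian square.
-/

namespace MTP2

open Matrix

variable {p : ℕ}

/-! ### Positive semidefinite bounds -/

theorem posSemidef_lamMax_sub {A : Matrix (Fin p) (Fin p) ℝ} (hA : A.IsHermitian) :
    (lamMax A • (1 : Matrix (Fin p) (Fin p) ℝ) - A).PosSemidef := by
  have hbdd : BddAbove (spectrum ℝ A) := by
    rw [hA.spectrum_real_eq_range_eigenvalues]
    exact (Set.finite_range _).bddAbove
  refine posSemidef_iff_isHermitian_and_spectrum_nonneg.2 ⟨?_, ?_⟩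
  · exact (isHermitian_one.smul (IsSelfAdjoint.all _)).sub hA
  · rw [← Algebra.algebraMap_eq_smul_one, ← spectrum.singleton_sub_eq]
    rintro x ⟨l, hl, y, hy, rfl⟩
    rw [Set.mem_singleton_iff.1 hl]
    exact sub_nonneg.2 (le_csSup hbdd hy)

/-- Inversion reverses the order against scalar matrices, by the identity
`A⁻¹ - L⁻¹ = (A⁻¹ - L⁻¹) A (A⁻¹ - L⁻¹) + L⁻² (L - A)`. -/
theorem posSemidef_inv_sub {A : Matrix (Fin p) (Fin p) ℝ} (hA : A.PosDef) {L : ℝ} (hL : 0 < L)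
    (h : (L • (1 : Matrix (Fin p) (Fin p) ℝ) - A).PosSemidef) :
    (A⁻¹ - L⁻¹ • (1 : Matrix (Fin p) (Fin p) ℝ)).PosSemidef := by
  have hu : IsUnit A.det := hA.det_pos.ne'.isUnit
  have hD : (A⁻¹ - L⁻¹ • (1 : Matrix (Fin p) (Fin p) ℝ)).IsHermitian :=
    hA.inv.isHermitian.sub (isHermitian_one.smul (IsSelfAdjoint.all _))
  have h1 := hA.posSemidef.conjTranspose_mul_mul_same (A⁻¹ - L⁻¹ • 1)
  have h2 := h.smul (show (0 : ℝ) ≤ L⁻¹ ^ 2 by positivity)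
  convert h1.add h2 using 1
  rw [hD.eq]
  simp only [sub_mul, mul_sub, nonsing_inv_mul _ hu, mul_nonsing_inv _ hu, smul_mul_assoc,
    mul_smul_comm, one_mul, mul_one, smul_sub, smul_smul]
  have : L⁻¹ ^ 2 * L = L⁻¹ := by field_simp
  rw [this]
  module

/-! ### The Frobenius norm and traces of products -/

theorem frobNorm_nonneg (A : Matrix (Fin p) (Fin p) ℝ) : 0 ≤ frobNorm A := by
  rw [frobNorm_eq_sqrt]; exact Real.sqrt_nonneg _

theorem frobNorm_sq (A : Matrix (Fin p) (Fin p) ℝ) : frobNorm A ^ 2 = ∑ i, ∑ j, A i j ^ 2 := by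
  rw [frobNorm_eq_sqrt, Real.sq_sqrt (by positivity)]

theorem posSemidef_frobNorm_sub {D : Matrix (Fin p) (Fin p) ℝ} (hD : D.IsHermitian) :
    (frobNorm D • (1 : Matrix (Fin p) (Fin p) ℝ) - D).PosSemidef := by
  refine PosSemidef.of_dotProduct_mulVec_nonneg
    ((isHermitian_one.smul (IsSelfAdjoint.all _)).sub hD) fun x => ?_
  rw [sub_mulVec, smul_mulVec, one_mulVec, dotProduct_sub, dotProduct_smul, star_trivial,
    sub_nonneg, smul_eq_mul]
  have hxx : 0 ≤ x ⬝ᵥ x := by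
    simpa [dotProduct] using Finset.sum_nonneg fun i _ => mul_self_nonneg (x i)
  refine abs_le_of_sq_le_sq' ?_ (mul_nonneg (frobNorm_nonneg D) hxx) |>.2
  have h1 : x ⬝ᵥ D *ᵥ x = ∑ e : Fin p × Fin p, D e.1 e.2 * (x e.1 * x e.2) := by
    rw [Fintype.sum_prod_type]
    simp only [dotProduct, mulVec, Finset.mul_sum]
    exact Finset.sum_congr rfl fun i _ => Finset.sum_congr rfl fun j _ => by ring
  have h2 : (x ⬝ᵥ x) ^ 2 = ∑ e : Fin p × Fin p, (x e.1 * x e.2) ^ 2 := by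
    rw [Fintype.sum_prod_type, sq, dotProduct, Finset.sum_mul_sum]
    exact Finset.sum_congr rfl fun i _ => Finset.sum_congr rfl fun j _ => by ring
  rw [mul_pow, h1, h2, frobNorm_sq, ← Fintype.sum_prod_type' (f := fun i j => D i j ^ 2)]
  exact Finset.sum_mul_sq_le_sq_mul_sq _ _ _

open scoped MatrixOrder in
theorem exists_eq_conjTranspose_mul_self {A : Matrix (Fin p) (Fin p) ℝ} (hA : A.PosSemidef) :
    ∃ R : Matrix (Fin p) (Fin p) ℝ, A = Rᴴ * R :=
  CStarAlgebra.nonneg_iff_eq_star_mul_self.1 hA.nonneg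

theorem trace_mul_nonneg {A B : Matrix (Fin p) (Fin p) ℝ} (hA : A.PosSemidef)
    (hB : B.PosSemidef) : 0 ≤ (A * B).trace := by
  obtain ⟨R, rfl⟩ := exists_eq_conjTranspose_mul_self hA
  rw [mul_assoc, trace_mul_comm]
  exact (hB.mul_mul_conjTranspose_same R).trace_nonneg

theorem trace_mul_self_eq_frobNorm_sq {D : Matrix (Fin p) (Fin p) ℝ} (hD : D.IsHermitian) :
    (D * D).trace = frobNorm D ^ 2 := by
  rw [frobNorm_sq, trace]
  simp only [diag, mul_apply]
  refine Finset.sum_congr rfl fun i _ => Finset.sum_congr rfl fun j _ => ?_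
  rw [show D j i = D i j by simpa using hD.apply i j, sq]

theorem mul_frobNorm_sq_le_trace {P Q D : Matrix (Fin p) (Fin p) ℝ} {a b : ℝ} (ha : 0 ≤ a)
    (hb : 0 ≤ b) (hP : (P - a • (1 : Matrix (Fin p) (Fin p) ℝ)).PosSemidef)
    (hQ : (Q - b • (1 : Matrix (Fin p) (Fin p) ℝ)).PosSemidef) (hD : D.IsHermitian) :
    a * b * frobNorm D ^ 2 ≤ (P * D * Q * D).trace := by
  have hQ' : Q.PosSemidef := by simpa using hQ.add (PosSemidef.one.smul hb)
  have h1 := trace_mul_nonneg hP (hQ'.conjTranspose_mul_mul_same D)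
  have h2 := (hQ.conjTranspose_mul_mul_same D).trace_nonneg
  rw [hD.eq] at h1 h2
  simp only [sub_mul, mul_sub, smul_mul_assoc, mul_smul_comm, one_mul, mul_one, trace_sub,
    trace_smul, smul_eq_mul, trace_mul_self_eq_frobNorm_sq hD, ← mul_assoc] at h1 h2
  nlinarith

/-! ### Concavity of the log-determinant -/

theorem log_det_le_trace_sub {N : Matrix (Fin p) (Fin p) ℝ} (hN : N.PosDef) :
    Real.log N.det ≤ N.trace - p := by
  have h1 : N.det = ∏ i, hN.isHermitian.eigenvalues i := by
    simpa using hN.isHermitian.det_eq_prod_eigenvalues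
  have h2 : N.trace = ∑ i, hN.isHermitian.eigenvalues i := by
    simpa using hN.isHermitian.trace_eq_sum_eigenvalues
  rw [h1, h2, Real.log_prod fun i _ => (hN.eigenvalues_pos i).ne']
  calc _ ≤ ∑ i, (hN.isHermitian.eigenvalues i - 1) :=
        Finset.sum_le_sum fun i _ => Real.log_le_sub_one_of_pos (hN.eigenvalues_pos i)
    _ = _ := by simp

/-- The tangent inequality expressing that `log det` is concave on positive definite matrices. -/
theorem log_det_sub_log_det_le {B C : Matrix (Fin p) (Fin p) ℝ} (hB : B.PosDef)
    (hC : C.PosDef) : Real.log B.det - Real.log C.det ≤ (C⁻¹ * (B - C)).trace := by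
  have hu : IsUnit C.det := hC.det_pos.ne'.isUnit
  obtain ⟨R, hR⟩ := exists_eq_conjTranspose_mul_self hC.inv.posSemidef
  have hdet : R.det * R.det = C.det⁻¹ := by
    have := congrArg det hR
    rw [det_nonsing_inv, det_mul, det_conjTranspose, Ring.inverse_eq_inv'] at this
    simpa using this.symm
  have hR0 : R.det ≠ 0 := fun h => by
    rw [h, zero_mul] at hdet
    exact inv_ne_zero hC.det_pos.ne' hdet.symm
  have hN : (R * B * Rᴴ).PosDef :=
    hB.mul_mul_conjTranspose_same
      (vecMul_injective_iff_isUnit.2 ((isUnit_iff_isUnit_det R).2 hR0.isUnit))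
  have h := log_det_le_trace_sub hN
  have e1 : (R * B * Rᴴ).det = B.det * C.det⁻¹ := by
    rw [det_mul, det_mul, det_conjTranspose, ← hdet, star_trivial]; ring
  have e2 : (R * B * Rᴴ).trace = (C⁻¹ * B).trace := by
    rw [trace_mul_comm, ← mul_assoc, ← hR]
  rw [e1, e2, Real.log_mul hB.det_pos.ne' (inv_ne_zero hC.det_pos.ne'), Real.log_inv] at h
  rw [mul_sub, nonsing_inv_mul _ hu, trace_sub, trace_one, Fintype.card_fin]
  linarith

/-! ### The basic inequality for minimizers -/

/-- The matrix `N` representing the penalty on M-matrices: `tr (Θ N) = ∑_{i ≠ j} Λᵢⱼ Θᵢⱼ`, so that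
`-tr (Θ N)` is the weighted `ℓ₁` penalty there. -/
def penaltyMatrix (Lam : Matrix (Fin p) (Fin p) ℝ) : Matrix (Fin p) (Fin p) ℝ :=
  Matrix.of fun i j => if j ≠ i then Lam j i else 0

/-- The penalty is linear on M-matrices, because their off-diagonal entries are nonpositive. -/
theorem objective_eq_of_mem {Shat Lam T : Matrix (Fin p) (Fin p) ℝ} (hT : T ∈ MMatrices p) :
    objective Shat Lam T = -Real.log T.det + (T * (Shat - penaltyMatrix Lam)).trace := by
  have h : (T * penaltyMatrix Lam).trace = - ∑ i, ∑ j, if i ≠ j then Lam i j * |T i j| else 0 := by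
    simp only [trace, diag, mul_apply, penaltyMatrix, of_apply, ← Finset.sum_neg_distrib]
    refine Finset.sum_congr rfl fun i _ => Finset.sum_congr rfl fun j _ => ?_
    split_ifs with hij
    · rw [abs_of_nonpos (hT.2 i j hij)]; ring
    · simp
  rw [mul_sub, trace_sub, h, objective]
  ring

theorem convex_MMatrices : Convex ℝ (MMatrices p) := by
  intro A hA B hB a b ha hb hab
  refine ⟨?_, fun i j hij => ?_⟩
  · rcases ha.eq_or_lt with rfl | ha
    · simpa [show b = 1 by linarith] using hB.1
    · exact (hA.1.smul ha).add_posSemidef (hB.1.posSemidef.smul hb)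
  · have h1 := mul_nonpos_of_nonneg_of_nonpos ha (hA.2 i j hij)
    have h2 := mul_nonpos_of_nonneg_of_nonpos hb (hB.2 i j hij)
    simpa using add_nonpos h1 h2

theorem convex_DDMMatrices : Convex ℝ (DDMMatrices p) := by
  intro A hA B hB a b ha hb hab
  refine ⟨convex_MMatrices hA.1 hB.1 ha hb hab, fun i => ?_⟩
  have h1 := mul_nonneg ha (hA.2 i)
  have h2 := mul_nonneg hb (hB.2 i)
  simpa [Finset.sum_add_distrib, Finset.mul_sum] using add_nonneg h1 h2

/-- Basic inequality for a minimizer `B` of the penalized likelihood. Testing minimality against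
points `C` of the segment from `B` to `A`, concavity of `log det` gives
`tr (D (Shat - N)) ≤ tr (C⁻¹ D)` with `D = B - A` and `N = penaltyMatrix Lam`; and
`A⁻¹ - C⁻¹ = A⁻¹ (C - A) C⁻¹` bounds `tr ((A⁻¹ - C⁻¹) D)` from below in terms of `‖D‖²`. The
point `C` then tends to `B`, which avoids differentiating the determinant. -/
theorem basic_inequality {S : Set (Matrix (Fin p) (Fin p) ℝ)} (hS : Convex ℝ S)
    (hSM : S ⊆ MMatrices p) {Shat Lam A B : Matrix (Fin p) (Fin p) ℝ} (hA : A ∈ S) (hB : B ∈ S)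
    (hmin : IsMinOn (objective Shat Lam) S B) (hL : 0 < lamMax A) :
    frobNorm (B - A) ^ 2 / (lamMax A * (lamMax A + frobNorm (B - A))) ≤
      ((B - A) * (A⁻¹ - Shat + penaltyMatrix Lam)).trace := by
  set D := B - A with hDdef
  set L := lamMax A
  set K := frobNorm D ^ 2 / (L * (L + frobNorm D)) with hK
  set M := Shat - penaltyMatrix Lam with hM
  have hF := frobNorm_nonneg D
  have hApd := (hSM hA).1
  have hBpd := (hSM hB).1
  have hD : D.IsHermitian := hBpd.isHermitian.sub hApd.isHermitian
  have hAu : IsUnit A.det := hApd.det_pos.ne'.isUnit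
  have hAL := posSemidef_lamMax_sub hApd.isHermitian
  have key : ∀ t ∈ Set.Ioo (0 : ℝ) 1, (1 - t) * K ≤ (D * (A⁻¹ - M)).trace := by
    rintro t ⟨ht0, ht1⟩
    set C := (1 - t) • B + t • A with hC
    have hCS : C ∈ S := hS hB hA (by linarith) ht0.le (by ring)
    have hCpd := (hSM hCS).1
    have hCu : IsUnit C.det := hCpd.det_pos.ne'.isUnit
    have hBC : B - C = t • D := by rw [hC, hDdef]; module
    have hCA : C - A = (1 - t) • D := by rw [hC, hDdef]; module
    have h1 : (D * M).trace ≤ (C⁻¹ * D).trace := by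
      have h := hmin hCS
      simp only [Set.mem_ofPred_eq] at h
      rw [objective_eq_of_mem (hSM hB), objective_eq_of_mem (hSM hCS), ← hM] at h
      have h' := log_det_sub_log_det_le hBpd hCpd
      have e : ((B - C) * M).trace = (B * M).trace - (C * M).trace := by rw [sub_mul, trace_sub]
      rw [hBC, mul_smul_comm, trace_smul, smul_eq_mul] at h'
      rw [hBC, smul_mul_assoc, trace_smul, smul_eq_mul] at e
      exact le_of_mul_le_mul_left (by linarith) ht0
    have h2 : (A⁻¹ - C⁻¹) * D = (1 - t) • (A⁻¹ * D * C⁻¹ * D) := by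
      have : A⁻¹ - C⁻¹ = A⁻¹ * (C - A) * C⁻¹ := by
        rw [mul_sub, sub_mul, nonsing_inv_mul _ hAu, one_mul, mul_assoc, mul_nonsing_inv _ hCu,
          mul_one]
      rw [this, hCA]
      simp only [mul_smul_comm, smul_mul_assoc]
    have hCL : ((L + frobNorm D) • (1 : Matrix (Fin p) (Fin p) ℝ) - C).PosSemidef := by
      have h3 := (posSemidef_frobNorm_sub hD).smul (show (0 : ℝ) ≤ 1 - t by linarith)
      have h4 := (PosSemidef.one (n := Fin p) (R := ℝ)).smul (mul_nonneg ht0.le hF)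
      convert (hAL.add h3).add h4 using 1
      rw [eq_add_of_sub_eq hCA]
      module
    have h5 := mul_frobNorm_sq_le_trace (by positivity) (by positivity)
      (posSemidef_inv_sub hApd hL hAL) (posSemidef_inv_sub hCpd (by positivity) hCL) hD
    have h6 : K = L⁻¹ * (L + frobNorm D)⁻¹ * frobNorm D ^ 2 := by
      rw [hK, div_eq_mul_inv, mul_inv]; ring
    rw [← h6] at h5
    have h7 := congrArg trace h2
    rw [sub_mul, trace_sub, trace_smul, smul_eq_mul] at h7
    have h8 := mul_le_mul_of_nonneg_left h5 (show (0 : ℝ) ≤ 1 - t by linarith)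
    rw [mul_sub, trace_sub, trace_mul_comm D A⁻¹]
    linarith
  rw [show A⁻¹ - Shat + penaltyMatrix Lam = A⁻¹ - M by rw [hM]; abel]
  have hlim : Filter.Tendsto (fun t : ℝ => (1 - t) * K) (nhdsWithin 0 (Set.Ioi 0))
      (nhds ((1 - 0) * K)) := by
    refine Filter.Tendsto.mono_left ?_ nhdsWithin_le_nhds
    exact Continuous.tendsto (by fun_prop) 0
  rw [sub_zero, one_mul] at hlim
  exact le_of_tendsto hlim (Filter.eventually_of_mem (Ioo_mem_nhdsGT one_pos) key)

/-! ### Norms of sets of entries -/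

theorem frobNorm_eq_entryNorm_univ (A : Matrix (Fin p) (Fin p) ℝ) :
    frobNorm A = entryNorm A Finset.univ := by
  rw [frobNorm_eq_sqrt, entryNorm, Fintype.sum_prod_type]

theorem entryNorm_mono (A : Matrix (Fin p) (Fin p) ℝ) {T U : Finset (Fin p × Fin p)}
    (h : T ⊆ U) : entryNorm A T ≤ entryNorm A U :=
  Real.sqrt_le_sqrt (Finset.sum_le_sum_of_subset_of_nonneg h fun _ _ _ => sq_nonneg _)

theorem entryNorm_le_frobNorm (A : Matrix (Fin p) (Fin p) ℝ) (T : Finset (Fin p × Fin p)) :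
    entryNorm A T ≤ frobNorm A := by
  rw [frobNorm_eq_entryNorm_univ]
  exact entryNorm_mono A (Finset.subset_univ T)

theorem entryNorm_le_mul_sqrt_card {A : Matrix (Fin p) (Fin p) ℝ} {T : Finset (Fin p × Fin p)}
    {h : ℝ} (hh : 0 ≤ h) (hA : ∀ e ∈ T, |A e.1 e.2| ≤ h) :
    entryNorm A T ≤ h * √(T.card : ℝ) := by
  rw [entryNorm, ← Real.sqrt_sq hh, ← Real.sqrt_mul (sq_nonneg h)]
  refine Real.sqrt_le_sqrt ?_
  calc _ ≤ ∑ _e ∈ T, h ^ 2 := Finset.sum_le_sum fun e he => by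
        rw [← sq_abs]; exact pow_le_pow_left₀ (abs_nonneg _) (hA e he) 2
    _ = _ := by rw [Finset.sum_const, nsmul_eq_mul, mul_comm]

theorem mul_sqrt_card_le_entryNorm {A : Matrix (Fin p) (Fin p) ℝ} {T : Finset (Fin p × Fin p)}
    {h : ℝ} (hh : 0 ≤ h) (hA : ∀ e ∈ T, h ≤ |A e.1 e.2|) :
    h * √(T.card : ℝ) ≤ entryNorm A T := by
  rw [entryNorm, ← Real.sqrt_sq hh, ← Real.sqrt_mul (sq_nonneg h)]
  refine Real.sqrt_le_sqrt ?_
  calc _ = ∑ _e ∈ T, h ^ 2 := by rw [Finset.sum_const, nsmul_eq_mul, mul_comm]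
    _ ≤ _ := Finset.sum_le_sum fun e he => by
        rw [← sq_abs (A _ _)]; exact pow_le_pow_left₀ hh (hA e he) 2

theorem sum_abs_mul_abs_le_entryNorm (A B : Matrix (Fin p) (Fin p) ℝ)
    (T : Finset (Fin p × Fin p)) :
    ∑ e ∈ T, |A e.1 e.2| * |B e.1 e.2| ≤ entryNorm A T * entryNorm B T := by
  have := Real.sum_mul_le_sqrt_mul_sqrt T (fun e => |A e.1 e.2|) (fun e => |B e.1 e.2|)
  simpa [entryNorm] using this

theorem sum_abs_le_sqrt_card_mul_entryNorm (B : Matrix (Fin p) (Fin p) ℝ)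
    (T : Finset (Fin p × Fin p)) :
    ∑ e ∈ T, |B e.1 e.2| ≤ √(T.card : ℝ) * entryNorm B T := by
  have := Real.sum_mul_le_sqrt_mul_sqrt T (fun _ => (1 : ℝ)) (fun e => |B e.1 e.2|)
  simpa [entryNorm] using this

/-! ### The error of one stage -/

/-- The off-diagonal positions where the entries of `D` are at least `r` in absolute value. -/
noncomputable def largePositions (D : Matrix (Fin p) (Fin p) ℝ) (r : ℝ) : Finset (Fin p × Fin p) :=
  Finset.univ.filter fun e => e.1 ≠ e.2 ∧ r ≤ |D e.1 e.2|

theorem mem_largePositions {D : Matrix (Fin p) (Fin p) ℝ} {r : ℝ} {e : Fin p × Fin p} :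
    e ∈ largePositions D r ↔ e.1 ≠ e.2 ∧ r ≤ |D e.1 e.2| := by
  simp [largePositions]

/-- Bound on one entry of the right-hand side of `basic_inequality`, where `W` is the noise
`Sig - Shat` and the weights come from `Prev`. Off the support `B - Th` is nonpositive, so an entry
of weight at least the noise level contributes nothing; the other entries off the support, and the
entries of the support whose weight has not vanished, are places where `Prev` is off by at least
`c₀ * lam`. -/
theorem entry_bound {Th B Prev W : Matrix (Fin p) (Fin p) ℝ} {w : ℝ → ℝ} {lam γ c₀ : ℝ}
    (hc₀ : 0 < c₀) (hlam : 0 < lam) (hw : WeightCond w lam γ c₀)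
    (hsig : ∀ e ∈ offDiagSupport Th, (c₀ + γ) * lam ≤ |Th e.1 e.2|)
    (hB : B ∈ MMatrices p) (hW : ∀ i j, |W i j| ≤ √2 / 2 * lam) (e : Fin p × Fin p) :
    (B - Th) e.1 e.2 * (W e.1 e.2 + if e.1 ≠ e.2 then w |Prev e.1 e.2| else 0) ≤
      (if e ∈ offDiagSupport Th ∪ diagPositions p then |W e.1 e.2| * |(B - Th) e.1 e.2| else 0) +
      (if e ∈ largePositions (Prev - Th) (c₀ * lam) then lam * |(B - Th) e.1 e.2| else 0) := by
  obtain ⟨i, j⟩ := e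
  have hWabs : (B - Th) i j * W i j ≤ |W i j| * |(B - Th) i j| := by
    rw [← abs_mul, mul_comm]; exact le_abs_self _
  have hlast : 0 ≤ if (i, j) ∈ largePositions (Prev - Th) (c₀ * lam) then
      lam * |(B - Th) i j| else 0 := by split_ifs <;> positivity
  have hw0 : 0 ≤ w |Prev i j| := hw.nonneg _ (abs_nonneg _)
  by_cases hij : i = j
  · have hT : (i, j) ∈ offDiagSupport Th ∪ diagPositions p := by simp [diagPositions, hij]
    simp only [ne_eq, hij, not_true_eq_false, if_false, add_zero] at *
    rw [if_pos hT]
    linarith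
  have hwlam : w |Prev i j| ≤ lam := by
    rw [← hw.at_zero]
    exact hw.anti Set.self_mem_Ici (Set.mem_Ici.2 (abs_nonneg _)) (abs_nonneg _)
  by_cases hTh : Th i j = 0
  · have hT : (i, j) ∉ offDiagSupport Th ∪ diagPositions p := by
      simp [offDiagSupport, diagPositions, hTh, hij]
    have hneg : (B - Th) i j ≤ 0 := by simpa [hTh] using hB.2 i j hij
    simp only [if_neg hT, ne_eq, hij, not_false_eq_true, if_true, zero_add]
    have hlow := neg_abs_le (W i j)
    by_cases hP : c₀ * lam ≤ |Prev i j|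
    · have hQ : (i, j) ∈ largePositions (Prev - Th) (c₀ * lam) :=
        mem_largePositions.2 ⟨hij, by simpa [hTh] using hP⟩
      rw [if_pos hQ, abs_of_nonpos hneg]
      have h2 : √2 ≤ 2 := Real.sqrt_le_iff.2 ⟨by norm_num, by norm_num⟩
      have h3 : -lam ≤ W i j + w |Prev i j| := by nlinarith [hW i j]
      linarith [mul_le_mul_of_nonpos_left h3 hneg]
    · refine le_trans ?_ hlast
      have h1 : w (c₀ * lam) ≤ w |Prev i j| :=
        hw.anti (Set.mem_Ici.2 (abs_nonneg _)) (Set.mem_Ici.2 (mul_pos hc₀ hlam).le) (not_le.1 hP).le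
      exact mul_nonpos_of_nonpos_of_nonneg hneg (by linarith [hW i j, hw.lower])
  · have hS : (i, j) ∈ offDiagSupport Th := by simp [offDiagSupport, hTh, hij]
    have hT : (i, j) ∈ offDiagSupport Th ∪ diagPositions p := Finset.mem_union_left _ hS
    simp only [if_pos hT, ne_eq, hij, not_false_eq_true, if_true]
    by_cases hP : γ * lam ≤ |Prev i j|
    · rw [hw.vanish _ hP, add_zero]
      linarith
    · have hQ : (i, j) ∈ largePositions (Prev - Th) (c₀ * lam) := by
        have h1 := hsig _ hS
        have h2 := abs_sub_abs_le_abs_sub (Th i j) (Prev i j)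
        rw [abs_sub_comm] at h2
        refine mem_largePositions.2 ⟨hij, ?_⟩
        simp only [Matrix.sub_apply] at h1 ⊢
        linarith [not_le.1 hP]
      rw [if_pos hQ, mul_add]
      have : (B - Th) i j * w |Prev i j| ≤ lam * |(B - Th) i j| := by
        calc _ ≤ |(B - Th) i j| * w |Prev i j| := mul_le_mul_of_nonneg_right (le_abs_self _) hw0
          _ ≤ |(B - Th) i j| * lam := mul_le_mul_of_nonneg_left hwlam (abs_nonneg _)
          _ = _ := mul_comm _ _
      linarith

/-- The error bound for one stage, whose weights are computed from a matrix `Prev`: the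
sum of the entrywise bounds of `entry_bound`, estimated by the Cauchy-Schwarz inequality. -/
theorem stage_bound {S : Set (Matrix (Fin p) (Fin p) ℝ)} (hS : Convex ℝ S)
    (hSM : S ⊆ MMatrices p) {Sig Shat Lam Th B Prev : Matrix (Fin p) (Fin p) ℝ} {w : ℝ → ℝ}
    {lam γ c₀ : ℝ} (hc₀ : 0 < c₀) (hlam : 0 < lam) (hw : WeightCond w lam γ c₀)
    (hsig : ∀ e ∈ offDiagSupport Th, (c₀ + γ) * lam ≤ |Th e.1 e.2|)
    (hLam : ∀ i j, i ≠ j → Lam i j = w |Prev i j|) (hSig : Th⁻¹ = Sig)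
    (hsymm : (Sig - Shat).IsHermitian) (hW : ∀ i j, |(Sig - Shat) i j| ≤ √2 / 2 * lam)
    (hTh : Th ∈ S) (hB : B ∈ S) (hmin : IsMinOn (objective Shat Lam) S B)
    (hL : 0 < lamMax Th) :
    frobNorm (B - Th) ≤ lamMax Th * (lamMax Th + frobNorm (B - Th)) *
      (entryNorm (Sig - Shat) (offDiagSupport Th ∪ diagPositions p) +
        lam * √((largePositions (Prev - Th) (c₀ * lam)).card : ℝ)) := by
  set T := offDiagSupport Th ∪ diagPositions p with hT
  set Q := largePositions (Prev - Th) (c₀ * lam) with hQ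
  set d := frobNorm (B - Th) with hd
  set R := entryNorm (Sig - Shat) T + lam * √(Q.card : ℝ) with hR
  have hd0 : 0 ≤ d := frobNorm_nonneg _
  have hR0 : 0 ≤ R := add_nonneg (Real.sqrt_nonneg _) (by positivity)
  have h1 : ((B - Th) * (Th⁻¹ - Shat + penaltyMatrix Lam)).trace = ∑ e : Fin p × Fin p,
      (B - Th) e.1 e.2 *
        ((Sig - Shat) e.1 e.2 + if e.1 ≠ e.2 then w |Prev e.1 e.2| else 0) := by
    rw [Fintype.sum_prod_type, hSig, trace]
    simp only [diag, mul_apply]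
    refine Finset.sum_congr rfl fun i _ => Finset.sum_congr rfl fun j _ => ?_
    have e1 : (Sig - Shat) j i = (Sig - Shat) i j := by simpa using hsymm.apply i j
    rw [Matrix.add_apply, e1, penaltyMatrix, of_apply]
    split_ifs with hij
    · rw [hLam i j hij]
    · rfl
  have h2 : ((B - Th) * (Th⁻¹ - Shat + penaltyMatrix Lam)).trace ≤ R * d := by
    rw [h1]
    refine (Finset.sum_le_sum fun e _ =>
      entry_bound hc₀ hlam hw hsig (hSM hB) hW e).trans ?_
    rw [Finset.sum_add_distrib, Finset.sum_ite_mem, Finset.sum_ite_mem, Finset.univ_inter,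
      Finset.univ_inter, ← Finset.mul_sum, hR, add_mul]
    have h3 := sum_abs_mul_abs_le_entryNorm (Sig - Shat) (B - Th) T
    have h4 := sum_abs_le_sqrt_card_mul_entryNorm (B - Th) Q
    have h5 : entryNorm (B - Th) T ≤ d := entryNorm_le_frobNorm _ _
    have h6 : entryNorm (B - Th) Q ≤ d := entryNorm_le_frobNorm _ _
    refine add_le_add (h3.trans (mul_le_mul_of_nonneg_left h5 (Real.sqrt_nonneg _))) ?_
    rw [mul_assoc]
    exact mul_le_mul_of_nonneg_left
      (h4.trans (mul_le_mul_of_nonneg_left h6 (Real.sqrt_nonneg _))) hlam.le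
  have h3 := (basic_inequality hS hSM hTh hB hmin hL).trans h2
  rw [← hd, div_le_iff₀ (by positivity)] at h3
  rcases hd0.eq_or_lt with h | h
  · rw [← h]; positivity
  · exact le_of_mul_le_mul_right (by linarith) h

/-! ### The recursion over the stages -/

/-- The error bound holds at every stage as soon as the entrywise noise is at most `√2 / 2 * lam`
and `lam` is small compared with `1 / √s`. Each estimate is within `L = lamMax Th` of `Th`, so
`stage_bound` becomes `e (k + 1) ≤ c₀ / 6 * ε + e k / 6` for the errors `e` and the noise norm `ε`,
which any contraction factor `ρ ≥ 1 / 6` absorbs. -/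
theorem multiStage_error_le {S : Set (Matrix (Fin p) (Fin p) ℝ)} (hS : Convex ℝ S)
    (hSM : S ⊆ MMatrices p) {Sig Shat Th : Matrix (Fin p) (Fin p) ℝ} {w : ℝ → ℝ}
    {lam γ c₀ ρ : ℝ} {s : ℕ} (hL : 0 < lamMax Th) (hc₀ : c₀ = 12 * lamMax Th ^ 2)
    (hρ : 1 / 6 ≤ ρ) (hlam : 0 < lam) (hw : WeightCond w lam γ c₀)
    (hprec : PrecisionCond Th s lam γ c₀) (hSig : Th⁻¹ = Sig)
    (hsymm : (Sig - Shat).IsHermitian) (hW : ∀ i j, |(Sig - Shat) i j| ≤ √2 / 2 * lam)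
    (hTh : Th ∈ S) (hsmall : 8 * c₀ * lam ^ 2 * s ≤ 1) {K : ℕ}
    {Θ : ℕ → Matrix (Fin p) (Fin p) ℝ} (hΘ : IsMultiStage S Shat w lam K Θ) :
    frobNorm (Θ K - Th) ≤
      4 * c₀ * entryNorm (Sig - Shat) (offDiagSupport Th ∪ diagPositions p) +
        ρ ^ K * frobNorm (Θ 0 - Th) := by
  set L := lamMax Th with hLdef
  set T := offDiagSupport Th ∪ diagPositions p with hT
  set ε := entryNorm (Sig - Shat) T with hε
  have hc₀' : 0 < c₀ := by rw [hc₀]; positivity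
  have hε0 : 0 ≤ ε := Real.sqrt_nonneg _
  have hr2 : √2 / 2 ≤ 0.71 := by
    have : √2 ≤ 1.42 := Real.sqrt_le_iff.2 ⟨by norm_num, by norm_num⟩
    linarith
  have hTs : T.card ≤ s := by
    refine (Finset.card_le_card fun e he => ?_).trans hprec.sparse
    rw [Finset.mem_filter]
    refine ⟨Finset.mem_univ _, ?_⟩
    rcases Finset.mem_union.1 he with he | he
    · exact (Finset.mem_filter.1 he).2.1
    · rw [← (Finset.mem_filter.1 he).2]
      exact ((hSM hTh).1.diag_pos).ne'
  -- `lam * √s` is at most `1 / (√96 * L)`, and `1 / √96 ≤ 0.103`.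
  have hy : L * (lam * √(s : ℝ)) ≤ 0.103 := by
    refine abs_le_of_sq_le_sq' ?_ (by norm_num) |>.2
    rw [mul_pow, mul_pow, Real.sq_sqrt (Nat.cast_nonneg s)]
    rw [hc₀] at hsmall
    nlinarith
  have hε1 : ε ≤ 0.71 * (lam * √(s : ℝ)) := by
    refine (entryNorm_le_mul_sqrt_card (h := √2 / 2 * lam) (by positivity)
      fun e _ => hW e.1 e.2).trans ?_
    have h1 : √(T.card : ℝ) ≤ √(s : ℝ) := Real.sqrt_le_sqrt (by exact_mod_cast hTs)
    rw [mul_assoc]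
    exact mul_le_mul hr2 (mul_le_mul_of_nonneg_left h1 hlam.le) (by positivity) (by norm_num)
  have hLε : L * ε ≤ 0.075 := by nlinarith
  -- each large position of the error contributes at least `c₀ * lam` to its norm
  have hcard : ∀ k, lam * √((largePositions (Θ k - Th) (c₀ * lam)).card : ℝ) ≤
      frobNorm (Θ k - Th) / c₀ := fun k => by
    rw [le_div_iff₀ hc₀']
    have := (mul_sqrt_card_le_entryNorm (A := Θ k - Th) (h := c₀ * lam) (by positivity)
      fun e he => (mem_largePositions.1 he).2).trans (entryNorm_le_frobNorm _ _)
    linarith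
  -- the initial matrix is diagonal, so it can be far off only on the support of `Th`
  have hcard0 : lam * √((largePositions (Θ 0 - Th) (c₀ * lam)).card : ℝ) ≤ lam * √(s : ℝ) := by
    refine mul_le_mul_of_nonneg_left (Real.sqrt_le_sqrt ?_) hlam.le
    have : largePositions (Θ 0 - Th) (c₀ * lam) ⊆ T := fun e he => by
      obtain ⟨h1, h2⟩ := mem_largePositions.1 he
      rw [Matrix.sub_apply, hΘ.init _ _ h1, zero_sub, abs_neg] at h2
      refine Finset.mem_union_left _ (Finset.mem_filter.2 ⟨Finset.mem_univ _, ?_, h1⟩)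
      exact abs_pos.1 ((mul_pos hc₀' hlam).trans_le h2)
    exact_mod_cast (Finset.card_le_card this).trans hTs
  have hstage : ∀ k < K, frobNorm (Θ (k + 1) - Th) ≤ L * (L + frobNorm (Θ (k + 1) - Th)) *
      (ε + lam * √((largePositions (Θ k - Th) (c₀ * lam)).card : ℝ)) := fun k hk => by
    refine stage_bound hS hSM hc₀' hlam hw hprec.signal (fun i j hij => ?_) hSig hsymm hW hTh
      (hΘ.mem k hk) (hΘ.isMin k hk) hL
    cases k with
    | zero => simp [stageWeights, hΘ.init i j hij, hw.at_zero]
    | succ k => rfl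
  -- The initial error is not bounded, hence the separate treatment of the first stage.
  have hclose : ∀ k < K, frobNorm (Θ (k + 1) - Th) ≤ L := fun k => by
    have aux : ∀ {d R : ℝ}, 0 ≤ d → L * R ≤ 0.2 → d ≤ L * (L + d) * R → d ≤ L :=
      fun {d R} hd hR h => by
        have : L * (L + d) * R ≤ 0.2 * (L + d) := by nlinarith
        linarith
    induction k with
    | zero => exact fun hk => aux (frobNorm_nonneg _) (by nlinarith) (hstage 0 hk)
    | succ k ih =>
      intro hk
      refine aux (frobNorm_nonneg _) ?_ (hstage (k + 1) hk)
      have h1 : L * (frobNorm (Θ (k + 1) - Th) / c₀) ≤ 1 / 12 := by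
        rw [← mul_div_assoc, div_le_iff₀ hc₀', hc₀]
        nlinarith [ih (by omega)]
      nlinarith [hcard (k + 1)]
  have hrec : ∀ k < K, frobNorm (Θ (k + 1) - Th) ≤ c₀ / 6 * ε + frobNorm (Θ k - Th) / 6 :=
    fun k hk => by
      have h1 : L * (L + frobNorm (Θ (k + 1) - Th)) ≤ c₀ / 6 := by
        rw [hc₀]; nlinarith [hclose k hk]
      refine (hstage k hk).trans ?_
      calc _ ≤ c₀ / 6 * (ε + frobNorm (Θ k - Th) / c₀) := by
            refine mul_le_mul h1 (by linarith [hcard k]) (by positivity) (by positivity)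
        _ = _ := by field_simp
  have main : ∀ k ≤ K, frobNorm (Θ k - Th) ≤ 4 * c₀ * ε + ρ ^ k * frobNorm (Θ 0 - Th) := by
    intro k
    induction k with
    | zero => intro _; rw [pow_zero, one_mul]; exact le_add_of_nonneg_left (by positivity)
    | succ k ih =>
      intro hk
      have h1 := hrec k hk
      have h2 := ih (by omega)
      have h3 : 0 ≤ c₀ * ε := by positivity
      have h4 : 0 ≤ ρ ^ k * frobNorm (Θ 0 - Th) :=
        mul_nonneg (pow_nonneg (by linarith) k) (frobNorm_nonneg _)
      rw [pow_succ]
      nlinarith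
  exact main K le_rfl

end MTP2

namespace MTP2

open scoped NNReal

/-! ### Squares of Gaussian variables -/

/-- The bound `-log (1 - y) ≤ y + y ^ 2` near zero, in multiplicative form. -/
theorem one_le_one_sub_mul_exp {y : ℝ} (hy : |y| ≤ 1 / 2) :
    1 ≤ (1 - y) * Real.exp (y + y ^ 2) := by
  obtain ⟨h1, h2⟩ := abs_le.1 hy
  rcases le_total y 0 with h | h
  · have := Real.add_one_le_exp (y + y ^ 2)
    have h3 : (1 - y) * (y + y ^ 2 + 1) ≤ (1 - y) * Real.exp (y + y ^ 2) :=
      mul_le_mul_of_nonneg_left this (by linarith)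
    nlinarith [mul_nonneg (neg_nonneg.2 h) (sq_nonneg y)]
  · have := Real.quadratic_le_exp_of_nonneg (show 0 ≤ y + y ^ 2 by positivity)
    have h3 : (1 - y) * (1 + (y + y ^ 2) + (y + y ^ 2) ^ 2 / 2) ≤
      (1 - y) * Real.exp (y + y ^ 2) := mul_le_mul_of_nonneg_left this (by linarith)
    have h4 : 0 ≤ (1 - y) * (1 + y) ^ 2 / 2 - y := by
      nlinarith [mul_nonneg h h, mul_nonneg h (sub_nonneg.2 h2)]
    nlinarith [mul_nonneg (sq_nonneg y) h4]

theorem integral_exp_mul_sq_gaussianReal {v : ℝ≥0} {t : ℝ} (ht : 2 * (t * v) < 1) :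
    ∫ x, Real.exp (t * x ^ 2) ∂(gaussianReal 0 v) = √((1 - 2 * (t * v))⁻¹) := by
  rcases eq_or_ne v 0 with rfl | hv
  · simp
  have hv' : (0 : ℝ) < v := by positivity
  rw [integral_gaussianReal_eq_integral_smul hv]
  have h : ∀ x : ℝ, gaussianPDFReal 0 v x • Real.exp (t * x ^ 2) =
      (√(2 * Real.pi * v))⁻¹ * Real.exp (-(1 / (2 * v) - t) * x ^ 2) := fun x => by
    rw [gaussianPDFReal_def, smul_eq_mul, mul_assoc, ← Real.exp_add]
    congr 2
    field_simp
    ring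
  simp_rw [h]
  rw [integral_const_mul, integral_gaussian, ← Real.sqrt_inv, ← Real.sqrt_mul (by positivity)]
  congr 1
  have h2 : 1 - 2 * (t * v) ≠ 0 := by linarith
  have h3 : 1 / (2 * (v : ℝ)) - t = (1 - 2 * (t * v)) / (2 * v) := by field_simp
  rw [h3]
  field_simp

/-- A centred Gaussian square is sub-exponential: near zero its moment generating function is
dominated by a Gaussian one. -/
theorem integral_exp_centered_sq_le {v : ℝ≥0} {t V : ℝ} (hv : v ≤ V) (ht : |t| * V ≤ 1 / 4) :
    0 < ∫ x, Real.exp (t * (x ^ 2 - v)) ∂(gaussianReal 0 v) ∧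
    ∫ x, Real.exp (t * (x ^ 2 - v)) ∂(gaussianReal 0 v) ≤ Real.exp (2 * t ^ 2 * V ^ 2) := by
  have hv0 : (0 : ℝ) ≤ v := v.2
  have hy : |2 * (t * v)| ≤ 1 / 2 := by
    rw [abs_mul, abs_mul, abs_of_nonneg hv0, abs_two]
    nlinarith [abs_nonneg t]
  have hlt : 2 * (t * v) < 1 := by linarith [(abs_le.1 hy).2]
  have h1 : ∫ x, Real.exp (t * (x ^ 2 - v)) ∂(gaussianReal 0 v) =
      √((1 - 2 * (t * v))⁻¹) * Real.exp (-(t * v)) := by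
    rw [← integral_exp_mul_sq_gaussianReal hlt, ← integral_mul_const]
    simp_rw [← Real.exp_add]
    congr 1 with x
    ring_nf
  have hpos : 0 < (1 - 2 * (t * v))⁻¹ := inv_pos.2 (by linarith)
  rw [h1]
  refine ⟨by positivity, ?_⟩
  have h2 : (1 - 2 * (t * v))⁻¹ ≤ Real.exp (2 * (t * v) + (2 * (t * v)) ^ 2) := by
    rw [inv_le_iff_one_le_mul₀' (by linarith)]
    exact one_le_one_sub_mul_exp hy
  have h3 : √((1 - 2 * (t * v))⁻¹) ≤ Real.exp (t * v + 2 * t ^ 2 * v ^ 2) := by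
    refine Real.sqrt_le_iff.2 ⟨(Real.exp_pos _).le, h2.trans (le_of_eq ?_)⟩
    rw [← Real.exp_nat_mul]
    congr 1
    push_cast
    ring
  calc _ ≤ Real.exp (t * v + 2 * t ^ 2 * v ^ 2) * Real.exp (-(t * v)) :=
        mul_le_mul_of_nonneg_right h3 (Real.exp_pos _).le
    _ = Real.exp (2 * t ^ 2 * v ^ 2) := by rw [← Real.exp_add]; congr 1; ring
    _ ≤ _ := Real.exp_le_exp.2 (mul_le_mul_of_nonneg_left (pow_le_pow_left₀ hv0 hv 2)
        (by positivity))

variable {Ω : Type*} [MeasurableSpace Ω] {P : Measure Ω} [IsProbabilityMeasure P]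

/-- Chernoff bound for the empirical second moment of independent `N(0, v)` variables. -/
theorem measureReal_le_abs_mean_sq_sub_le {n : ℕ} (hn : 1 ≤ n) {Y : Fin n → Ω → ℝ} {v : ℝ≥0}
    (hY : ∀ t, HasLaw (Y t) (gaussianReal 0 v) P) (hind : iIndepFun Y P) {V ε : ℝ} (hV : 0 < V)
    (hv : v ≤ V) (hε : 0 ≤ ε) (hεV : ε ≤ V) :
    P.real {ω | ε ≤ |1 / (n : ℝ) * ∑ t, Y t ω ^ 2 - v|} ≤
      2 * Real.exp (-(n * ε ^ 2 / (8 * V ^ 2))) := by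
  have hn0 : (0 : ℝ) < n := by exact_mod_cast hn
  set Z : Fin n → Ω → ℝ := fun t => (fun y => y ^ 2 - (v : ℝ)) ∘ Y t with hZ
  have hZind : iIndepFun Z P := hind.comp (fun _ y => y ^ 2 - (v : ℝ)) fun _ => by fun_prop
  have hZm : ∀ t, AEMeasurable (Z t) P := fun t =>
    (show Measurable fun y : ℝ => y ^ 2 - (v : ℝ) by fun_prop).comp_aemeasurable (hY t).aemeasurable
  have hmgf : ∀ t r, mgf (Z t) P r = ∫ x, Real.exp (r * (x ^ 2 - v)) ∂(gaussianReal 0 v) :=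
    fun t r => (hY t).integral_comp (f := fun x => Real.exp (r * (x ^ 2 - v)))
      (Measurable.aestronglyMeasurable (by fun_prop))
  have hsum : ∀ r, |r| * V ≤ 1 / 4 → 0 < mgf (∑ t, Z t) P r ∧
      mgf (∑ t, Z t) P r ≤ Real.exp (n * (2 * r ^ 2 * V ^ 2)) := fun r hr => by
    have h := integral_exp_centered_sq_le hv hr
    rw [hZind.mgf_sum₀ hZm]
    simp_rw [hmgf]
    rw [Finset.prod_const, Finset.card_univ, Fintype.card_fin, Real.exp_nat_mul]
    exact ⟨pow_pos h.1 n, pow_le_pow_left₀ h.1.le h.2 n⟩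
  have hint : ∀ r, |r| * V ≤ 1 / 4 → Integrable (fun ω => Real.exp (r * (∑ t, Z t) ω)) P :=
    fun r hr => by
      -- a function that is not integrable has integral zero
      by_contra hcon
      have := (hsum r hr).1
      rw [mgf, integral_undef hcon] at this
      exact lt_irrefl _ this
  -- the minimizer of the Chernoff exponent `-r * (n * ε) + 2 * n * r ^ 2 * V ^ 2`
  set r := ε / (4 * V ^ 2) with hr
  have hr0 : 0 ≤ r := by positivity
  have hrV : |r| * V ≤ 1 / 4 := by
    rw [abs_of_nonneg hr0, hr, div_mul_eq_mul_div, div_le_iff₀ (by positivity)]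
    nlinarith
  have hexp : Real.exp (-r * (n * ε)) * Real.exp (n * (2 * r ^ 2 * V ^ 2)) =
      Real.exp (-(n * ε ^ 2 / (8 * V ^ 2))) := by
    rw [← Real.exp_add, hr]
    congr 1
    field_simp
    ring
  have hup : P.real {ω | n * ε ≤ (∑ t, Z t) ω} ≤ Real.exp (-(n * ε ^ 2 / (8 * V ^ 2))) := by
    rw [← hexp]
    exact (measure_ge_le_exp_mul_mgf (n * ε) hr0 (hint r hrV)).trans
      (mul_le_mul_of_nonneg_left (hsum r hrV).2 (Real.exp_pos _).le)
  have hlow : P.real {ω | (∑ t, Z t) ω ≤ -(n * ε)} ≤ Real.exp (-(n * ε ^ 2 / (8 * V ^ 2))) := by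
    have hrV' : |(-r)| * V ≤ 1 / 4 := by rwa [abs_neg]
    have h2 := (hsum (-r) hrV').2
    rw [neg_sq] at h2
    rw [← hexp]
    refine (measure_le_le_exp_mul_mgf (-(n * ε)) (neg_nonpos.2 hr0) (hint (-r) hrV')).trans ?_
    rw [neg_mul_neg, neg_mul]
    exact mul_le_mul_of_nonneg_left h2 (Real.exp_pos _).le
  have hsub : {ω | ε ≤ |1 / (n : ℝ) * ∑ t, Y t ω ^ 2 - v|} ⊆
      {ω | n * ε ≤ (∑ t, Z t) ω} ∪ {ω | (∑ t, Z t) ω ≤ -(n * ε)} := fun ω hω => by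
    have e : (∑ t, Z t) ω = n * (1 / (n : ℝ) * ∑ t, Y t ω ^ 2 - v) := by
      simp only [hZ, Finset.sum_apply, Function.comp_apply, Finset.sum_sub_distrib,
        Finset.sum_const, Finset.card_univ, Fintype.card_fin, nsmul_eq_mul]
      field_simp
    simp only [Set.mem_union, Set.mem_ofPred_eq] at hω ⊢
    rw [e]
    rcases le_abs.1 hω with h | h
    · exact Or.inl (mul_le_mul_of_nonneg_left h hn0.le)
    · right
      rw [← mul_neg]
      exact mul_le_mul_of_nonneg_left (by linarith) hn0.le
  calc _ ≤ _ := measureReal_mono hsub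
    _ ≤ _ := measureReal_union_le _ _
    _ ≤ _ := by linarith

/-! ### The sample covariance -/

variable {p : ℕ}

theorem variance_pair_multivariateGaussian {Sig : Matrix (Fin p) (Fin p) ℝ}
    (hSig : Sig.PosSemidef) (c : ℝ) (i j : Fin p) :
    Var[fun x : EuclideanSpace ℝ (Fin p) => x i + c * x j; multivariateGaussian 0 Sig] =
      Sig i i + 2 * c * Sig i j + c ^ 2 * Sig j j := by
  have hm : ∀ k, MemLp (fun x : EuclideanSpace ℝ (Fin p) => x k) 2 (multivariateGaussian 0 Sig) :=
    fun k => (IsGaussian.memLp_dual (multivariateGaussian 0 Sig)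
      (EuclideanSpace.proj k : EuclideanSpace ℝ (Fin p) →L[ℝ] ℝ) 2 (by simp))
  rw [variance_fun_add (hm i) ((hm j).const_mul c), variance_const_mul, covariance_const_mul_right,
    variance_eval_multivariateGaussian hSig, variance_eval_multivariateGaussian hSig,
    covariance_eval_multivariateGaussian hSig]
  ring

theorem hasLaw_pair_multivariateGaussian {Sig : Matrix (Fin p) (Fin p) ℝ}
    (hSig : Sig.PosSemidef) (c : ℝ) (i j : Fin p) :
    HasLaw (fun x : EuclideanSpace ℝ (Fin p) => x i + c * x j)
      (gaussianReal 0 (Sig i i + 2 * c * Sig i j + c ^ 2 * Sig j j).toNNReal)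
      (multivariateGaussian 0 Sig) where
  aemeasurable := Measurable.aemeasurable (by fun_prop)
  map_eq := by
    let l : EuclideanSpace ℝ (Fin p) →L[ℝ] ℝ :=
      EuclideanSpace.proj i + c • EuclideanSpace.proj j
    have hl : (fun x : EuclideanSpace ℝ (Fin p) => x i + c * x j) = l := by ext; simp [l]
    rw [← variance_pair_multivariateGaussian hSig, hl, IsGaussian.map_eq_gaussianReal,
      ContinuousLinearMap.integral_comp_id_comm IsGaussian.integrable_id]
    simp

end MTP2

namespace MTP2

variable {Ω : Type*} [MeasurableSpace Ω] {P : Measure Ω} [IsProbabilityMeasure P] {p n : ℕ}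

/-- Tail bound for one entry of the sample covariance. By polarization
`4 xᵢ xⱼ = (xᵢ + xⱼ)² - (xᵢ - xⱼ)²`, the error is a combination of the errors of the empirical
second moments of two Gaussian samples, with variances at most `4 * M`. -/
theorem measureReal_le_abs_sampleCov_sub_le (hn : 1 ≤ n) {Sig : Matrix (Fin p) (Fin p) ℝ}
    (hSig : Sig.PosSemidef) {X : Fin n → Ω → EuclideanSpace ℝ (Fin p)}
    (hlaw : ∀ t, HasLaw (X t) (multivariateGaussian 0 Sig) P) (hindep : iIndepFun X P)
    {M δ : ℝ} (hM : 0 < M) (hdiag : ∀ i, Sig i i ≤ M) (hδ : 0 ≤ δ) (hδM : δ ≤ 2 * M)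
    (i j : Fin p) :
    P.real {ω | δ ≤ |(Sig - sampleCov fun t => X t ω) i j|} ≤
      4 * Real.exp (-(n * δ ^ 2 / (32 * M ^ 2))) := by
  have hnonneg : ∀ c : ℝ, 0 ≤ Sig i i + 2 * c * Sig i j + c ^ 2 * Sig j j := fun c => by
    rw [← variance_pair_multivariateGaussian hSig]; exact variance_nonneg _ _
  have hp1 := hnonneg 1
  have hm1 := hnonneg (-1)
  have htail : ∀ c : ℝ, Sig i i + 2 * c * Sig i j + c ^ 2 * Sig j j ≤ 4 * M →
      P.real {ω | 2 * δ ≤ |1 / (n : ℝ) * ∑ t, (X t ω i + c * X t ω j) ^ 2 -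
        (Sig i i + 2 * c * Sig i j + c ^ 2 * Sig j j)|} ≤
      2 * Real.exp (-(n * δ ^ 2 / (32 * M ^ 2))) := fun c hc => by
    have h := measureReal_le_abs_mean_sq_sub_le hn
      (Y := fun t => (fun x : EuclideanSpace ℝ (Fin p) => x i + c * x j) ∘ X t)
      (fun t => (hasLaw_pair_multivariateGaussian hSig c i j).comp (hlaw t))
      (hindep.comp (fun _ (x : EuclideanSpace ℝ (Fin p)) => x i + c * x j) fun _ => by fun_prop)
      (V := 4 * M) (ε := 2 * δ) (by positivity)
      (by rwa [Real.coe_toNNReal _ (hnonneg c)]) (by positivity) (by linarith)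
    rw [Real.coe_toNNReal _ (hnonneg c)] at h
    refine h.trans (le_of_eq ?_)
    congr 3
    field_simp
    ring
  have h1 := htail 1 (by linarith [hdiag i, hdiag j])
  have h2 := htail (-1) (by linarith [hdiag i, hdiag j])
  set U := {ω | 2 * δ ≤ |1 / (n : ℝ) * ∑ t, (X t ω i + 1 * X t ω j) ^ 2 -
        (Sig i i + 2 * 1 * Sig i j + 1 ^ 2 * Sig j j)|}
  set V := {ω | 2 * δ ≤ |1 / (n : ℝ) * ∑ t, (X t ω i + -1 * X t ω j) ^ 2 -
        (Sig i i + 2 * -1 * Sig i j + (-1) ^ 2 * Sig j j)|}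
  have hsub : {ω | δ ≤ |(Sig - sampleCov fun t => X t ω) i j|} ⊆ U ∪ V := fun ω hω => by
    by_contra hcon
    rw [Set.mem_union, not_or] at hcon
    obtain ⟨hU, hV⟩ := hcon
    simp only [U, V, Set.mem_ofPred_eq, not_le] at hU hV hω
    have e : ∑ t, X t ω i * X t ω j =
        (∑ t, (X t ω i + 1 * X t ω j) ^ 2 - ∑ t, (X t ω i + -1 * X t ω j) ^ 2) / 4 := by
      rw [← Finset.sum_sub_distrib, Finset.sum_div]
      exact Finset.sum_congr rfl fun t _ => by ring
    rw [Matrix.sub_apply, sampleCov, Matrix.of_apply, e] at hω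
    rw [abs_lt] at hU hV
    refine absurd hω (not_le.2 (abs_lt.2 ⟨?_, ?_⟩)) <;> linarith [hU.1, hU.2, hV.1, hV.2]
  calc _ ≤ _ := measureReal_mono hsub
    _ ≤ _ := measureReal_union_le _ _
    _ ≤ _ := by linarith

/-- The sample covariance is uniformly close to the covariance on a measurable event of large
probability. The observations are only a.e. measurable, so the event is the complement of a
measurable hull of the set of bad outcomes. -/
theorem exists_event_abs_sampleCov_sub_lt (hn : 1 ≤ n) {Sig : Matrix (Fin p) (Fin p) ℝ}
    (hSig : Sig.PosSemidef) {X : Fin n → Ω → EuclideanSpace ℝ (Fin p)}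
    (hlaw : ∀ t, HasLaw (X t) (multivariateGaussian 0 Sig) P) (hindep : iIndepFun X P)
    {M δ : ℝ} (hM : 0 < M) (hdiag : ∀ i, Sig i i ≤ M) (hδ : 0 ≤ δ) (hδM : δ ≤ 2 * M) :
    ∃ E : Set Ω, MeasurableSet E ∧
      1 - p ^ 2 * (4 * Real.exp (-(n * δ ^ 2 / (32 * M ^ 2)))) ≤ P.real E ∧
      ∀ ω ∈ E, ∀ i j, |(Sig - sampleCov fun t => X t ω) i j| < δ := by
  set B := ⋃ e : Fin p × Fin p, {ω | δ ≤ |(Sig - sampleCov fun t => X t ω) e.1 e.2|} with hB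
  refine ⟨(toMeasurable P B)ᶜ, (measurableSet_toMeasurable P B).compl, ?_, fun ω hω i j => ?_⟩
  · rw [probReal_compl_eq_one_sub (measurableSet_toMeasurable P B), measureReal_def,
      measure_toMeasurable, ← measureReal_def]
    refine sub_le_sub_left ((measureReal_iUnion_fintype_le _).trans ?_) 1
    refine (Finset.sum_le_sum fun e _ => measureReal_le_abs_sampleCov_sub_le hn hSig hlaw hindep
      hM hdiag hδ hδM e.1 e.2).trans (le_of_eq ?_)
    simp only [Finset.sum_const, Finset.card_univ, Fintype.card_prod, Fintype.card_fin,
      nsmul_eq_mul]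
    push_cast
    ring
  · by_contra hcon
    exact hω (subset_toMeasurable P B (Set.mem_iUnion.2 ⟨(i, j), not_lt.1 hcon⟩))

end MTP2

/-! ### The high-probability error bound -/

theorem theorem3 {Ω : Type*} [MeasurableSpace Ω] (P : Measure Ω) [IsProbabilityMeasure P]
    (p n s : ℕ) (hp : 1 ≤ p) (hn : 1 ≤ n)
    (S : Set (Matrix (Fin p) (Fin p) ℝ)) (hS : S = MTP2.MMatrices p ∨ S = MTP2.DDMMatrices p)
    (Sig Th : Matrix (Fin p) (Fin p) ℝ) (hSig : Sig.PosDef) (hTh : Th = Sig⁻¹) (hThS : Th ∈ S)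
    (X : Fin n → Ω → EuclideanSpace ℝ (Fin p))
    (hlaw : ∀ t, HasLaw (X t) (multivariateGaussian 0 Sig) P) (hindep : iIndepFun X P)
    (w : ℝ → ℝ) (lam γ τ c₀ c₁ ρ : ℝ)
    (hc₀ : c₀ = 12 * MTP2.lamMax Th ^ 2)
    (hc₁ : c₁ = (80 * ⨆ i, Sig i i) ^ 2)
    (hρ : ρ = (2 + Real.sqrt 2) / 4)
    (hw : MTP2.WeightCond w lam γ c₀)
    (hprec : MTP2.PrecisionCond Th s lam γ c₀)
    (hτ : 2 < τ)
    (hlam : lam = Real.sqrt (c₁ * τ * Real.log p / n))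
    (hsample : 8 * c₀ * c₁ * τ * s * Real.log p ≤ n) :
    ∃ E : Set Ω, MeasurableSet E ∧ 1 - 4 / (p : ℝ) ^ (τ - 2) ≤ P.real E ∧
      ∀ ω ∈ E, ∀ (k : ℕ) (Θ : ℕ → Matrix (Fin p) (Fin p) ℝ),
        MTP2.IsMultiStage S (MTP2.sampleCov fun t => X t ω) w lam k Θ →
          MTP2.frobNorm (Θ k - Th) ≤
            4 * c₀ * MTP2.entryNorm (Sig - MTP2.sampleCov fun t => X t ω)
                (MTP2.offDiagSupport Th ∪ MTP2.diagPositions p)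
              + ρ ^ k * MTP2.frobNorm (Θ 0 - Th) := by
  open MTP2 in
  rcases hp.eq_or_lt with hp1 | hp1
  -- For `p = 1` the claimed probability `1 - 4` is negative, and `lam = 0`.
  · refine ⟨∅, MeasurableSet.empty, ?_, fun ω hω => hω.elim⟩
    rw [← hp1]
    norm_num
  have hn0 : (0 : ℝ) < n := by exact_mod_cast hn
  have hp0 : (0 : ℝ) < p := by exact_mod_cast hp
  have hlog : 0 < Real.log p := Real.log_pos (by exact_mod_cast hp1)
  have hconv : Convex ℝ S := by
    rcases hS with rfl | rfl
    exacts [convex_MMatrices, convex_DDMMatrices]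
  have hSM : S ⊆ MMatrices p := by
    rcases hS with rfl | rfl
    exacts [subset_rfl, fun A hA => hA.1]
  have hinv : Th⁻¹ = Sig := by
    rw [hTh, Matrix.nonsing_inv_nonsing_inv _ hSig.det_pos.ne'.isUnit]
  have hL : 0 < lamMax Th := by
    obtain ⟨δ, h1, h2, h3, -⟩ := hprec.eigen
    linarith
  set M := ⨆ i, Sig i i with hMdef
  have hdiag : ∀ i, Sig i i ≤ M := fun i => le_ciSup (f := fun i => Sig i i)
    (Set.finite_range _).bddAbove i
  have hML : (lamMax Th)⁻¹ ≤ M := by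
    have hThpd := (hSM hThS).1
    have h := (posSemidef_inv_sub hThpd hL (posSemidef_lamMax_sub hThpd.isHermitian)).diag_nonneg
      (i := ⟨0, hp⟩)
    simp only [hinv, Matrix.sub_apply, Matrix.smul_apply, Matrix.one_apply_eq, smul_eq_mul,
      mul_one] at h
    linarith [hdiag ⟨0, hp⟩]
  have hM : 0 < M := (inv_pos.2 hL).trans_le hML
  have harg : 0 < c₁ * τ * Real.log p / n := by rw [hc₁]; positivity
  have hlam0 : 0 < lam := by rw [hlam]; exact Real.sqrt_pos.2 harg
  have hlamsq : lam ^ 2 = (80 * M) ^ 2 * τ * Real.log p / n := by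
    rw [hlam, Real.sq_sqrt harg.le, hc₁]
  have hsmall : 8 * c₀ * lam ^ 2 * s ≤ 1 := by
    rw [hlamsq, ← hc₁, ← mul_div_assoc, div_mul_eq_mul_div, div_le_one hn0]
    linarith
  -- the diagonal of `Th` does not vanish
  have hs : 1 ≤ s := by
    refine le_trans (Finset.card_pos.2 ⟨(⟨0, hp⟩, ⟨0, hp⟩), ?_⟩) hprec.sparse
    simpa using ((hSM hThS).1.diag_pos).ne'
  -- `lam ≤ M` places the deviation `√2 / 2 * lam` in the sub-Gaussian range of the tail bound
  have hlamM : lam ≤ M := by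
    have h1 : (1 : ℝ) ≤ s := by exact_mod_cast hs
    have h2 : 1 ≤ (lamMax Th * M) ^ 2 :=
      one_le_pow₀ (by rwa [inv_le_iff_one_le_mul₀' hL] at hML)
    have h3 : 8 * c₀ * lam ^ 2 ≤ 1 := by
      refine le_trans (le_mul_of_one_le_right ?_ h1) hsmall
      rw [hc₀]; positivity
    rw [hc₀] at h3
    have h4 : (lamMax Th * lam) ^ 2 ≤ (lamMax Th * M) ^ 2 := by
      rw [mul_pow] at h2 ⊢
      nlinarith [sq_nonneg (lamMax Th * lam)]
    exact le_of_mul_le_mul_left ((sq_le_sq₀ (by positivity) (by positivity)).1 h4) hL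
  have hr2 : √2 ≤ 2 := Real.sqrt_le_iff.2 ⟨by norm_num, by norm_num⟩
  obtain ⟨E, hE, hPE, hgood⟩ := exists_event_abs_sampleCov_sub_lt hn hSig.posSemidef hlaw hindep
    hM hdiag (δ := √2 / 2 * lam) (by positivity) (by nlinarith)
  refine ⟨E, hE, le_trans (sub_le_sub_left ?_ 1) hPE, fun ω hω k Θ hΘ => ?_⟩
  · have h1 : n * (√2 / 2 * lam) ^ 2 / (32 * M ^ 2) = 100 * τ * Real.log p := by
      rw [mul_pow, div_pow, Real.sq_sqrt (by norm_num), hlamsq]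
      field_simp
      norm_num
    have h2 : Real.exp (-(100 * τ * Real.log p)) ≤ (p : ℝ) ^ (-τ) := by
      rw [Real.rpow_def_of_pos hp0]
      exact Real.exp_le_exp.2 (by nlinarith [mul_pos hlog (show 0 < τ by linarith)])
    have h3 : (4 : ℝ) / (p : ℝ) ^ (τ - 2) = p ^ 2 * (4 * (p : ℝ) ^ (-τ)) := by
      rw [div_eq_mul_inv, ← Real.rpow_neg hp0.le, neg_sub, sub_eq_add_neg, Real.rpow_add hp0,
        Real.rpow_two]
      ring
    rw [h1, h3]
    exact mul_le_mul_of_nonneg_left (mul_le_mul_of_nonneg_left h2 (by norm_num)) (by positivity)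
  · refine multiStage_error_le hconv hSM hL hc₀ ?_ hlam0 hw hprec hinv ?_
      (fun i j => (hgood ω hω i j).le) hThS hsmall hΘ
    · rw [hρ]; linarith [Real.sqrt_nonneg 2]
    · refine hSig.isHermitian.sub (Matrix.IsHermitian.ext fun i j => ?_)
      simp [sampleCov, mul_comm]
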